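/- For complex $a,q$ with $|q|<1$ and $n\in\mathbb{N}\cup\{\infty\}$ write $(a)_n=(a;q)_n=\prod_{k=1}^{n}(1-aq^{k-1})$ (empty product $=1$) and $(a_1,\dots,a_m)_n=(a_1)_n\cdots(a_m)_n$. Let $d,e,x,z,q$ be complex numbers with $0<|q|<1$, $d,e,z\neq 0$ and $|xdeq|<1$, and suppose that no denominator below vanishes, i.e. that for every integer $n\ge 1$ none of $zq^n$, $xq^n/z$, $xq^n$, $-xdq^n$, $-xeq^n$ equals $1$. Then both series below converge absolutely, and $$\sum_{n\ge 0}\frac{(-1/d,-1/e)_n\,(xdeq)^n}{(zq,xq/z)_n} =1-\frac{(-xqd,-xqe)_\infty}{(xq,xqde)_\infty}\sum_{n\ge 1}\frac{(xq,-1/d,-1/e)_n\,q^{n(n+3)/2}(-dex)^n}{(q)_{n-1}(-xdq,-xeq)_n}\left(\frac{1}{q^n(1-zq^n)}+\frac{xz^{-1}}{1-xq^n/z}\right).$$ -/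

import Mathlib

/-- The finite `q`-shifted factorial `(a; q)_n = ∏_{k=1}^{n} (1 - a q^{k-1})`. -/
noncomputable def qPoch (a q : ℂ) (n : ℕ) : ℂ :=
  ∏ k ∈ Finset.range n, (1 - a * q ^ k)

/-- The infinite `q`-shifted factorial `(a; q)_∞ = ∏_{k ≥ 1} (1 - a q^{k-1})`, for `|q| < 1`. -/
noncomputable def qPochInf (a q : ℂ) : ℂ :=
  ∏' k : ℕ, (1 - a * q ^ k)

/-- For `|q| < 1` the infinite product `(a; q)_∞` converges, so `qPochInf` is its true value. -/
theorem multipliable_qPochInf (a q : ℂ) (hq : ‖q‖ < 1) :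
    Multipliable (fun k : ℕ => 1 - a * q ^ k) := by
  have h : Summable (fun k : ℕ => ‖-(a * q ^ k)‖) := by
    simpa [norm_mul, norm_pow] using
      (summable_geometric_of_lt_one (norm_nonneg q) hq).mul_left ‖a‖
  simpa [sub_eq_add_neg] using multipliable_one_add_of_summable h

/-- The `n`-th term `(-1/d, -1/e)_n (xdeq)^n / (zq, xq/z)_n` of the rank generating function. -/
noncomputable def rankTerm (d e x z q : ℂ) (n : ℕ) : ℂ :=
  qPoch (-1 / d) q n * qPoch (-1 / e) q n * (x * d * e * q) ^ n /
    (qPoch (z * q) q n * qPoch (x * q / z) q n)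

/-- The `n`-th term (`n ≥ 1`) of the Lambert-type series. The exponent `n (n + 3) / 2` is
an exact division of natural numbers. -/
noncomputable def lambertTerm (d e x z q : ℂ) (n : ℕ) : ℂ :=
  qPoch (x * q) q n * qPoch (-1 / d) q n * qPoch (-1 / e) q n *
      q ^ (n * (n + 3) / 2) * (-(d * e * x)) ^ n /
    (qPoch q q (n - 1) * qPoch (-(x * d * q)) q n * qPoch (-(x * e * q)) q n) *
    (1 / (q ^ n * (1 - z * q ^ n)) + x * z⁻¹ / (1 - x * q ^ n / z))

/-!
The identity is Bailey's lemma applied to a Bailey pair obtained from partial fractions.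

With `u = z + x/z` one has `(1 - zq^k)(1 - xq^k/z) = q^k (q^{-k} + xq^k - u)`, so for `n ≥ 1` the
function `1 / (zq, xq/z; q)_n` has a partial fraction expansion in `u`,
`1 / (zq, xq/z; q)_n = ∑_{i ≤ n} α_i / ((q; q)_{n-i} (xq; q)_{n+i})`, with `α_0 = 0` and
`α_i` proportional to `1 / ((1 - zq^i)(1 - xq^i/z))`. The right-hand side is `0` for `n = 0`, which
accounts for the isolated `1` in the theorem. The expansion is `sum_antidiagonal_pairAlpha`, proved
by induction on `n`; what the induction needs is that the residues sum to zero
(`sum_antidiagonal_pairNum`), and this sum telescopes.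

Multiplying by `(-1/d, -1/e; q)_n (xdeq)^n`, summing over `n` and interchanging the summations
(`bailey_transform`) leaves an inner sum which is a `₂φ₁` of `q`-Gauss type. The `q`-Gauss formula
(`tsum_gaussTerm`) comes from iterating the contiguous relation between `t` and `tq`
(`tsum_gaussTerm_contiguous`) and passing to the limit by dominated convergence. All estimates rest
on one fact: `(a; q)_n` converges, to a nonzero limit if no factor vanishes, so it and its inverse
are bounded, and the double series is dominated by a product of geometric series in `xdeq`.
-/

open Filter Topology
open Finset.HasAntidiagonal (antidiagonal)

/-! ### Finite and infinite `q`-shifted factorials -/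

theorem qPoch_zero (a q : ℂ) : qPoch a q 0 = 1 := by simp [qPoch]

theorem qPoch_succ (a q : ℂ) (n : ℕ) : qPoch a q (n + 1) = qPoch a q n * (1 - a * q ^ n) := by
  simp [qPoch, Finset.prod_range_succ]

theorem qPoch_add (a q : ℂ) (m n : ℕ) :
    qPoch a q (m + n) = qPoch a q m * qPoch (a * q ^ m) q n := by
  simp only [qPoch, Finset.prod_range_add]
  congr 1
  refine Finset.prod_congr rfl fun k _ => ?_
  ring

theorem qPoch_succ' (a q : ℂ) (n : ℕ) :
    qPoch a q (n + 1) = (1 - a) * qPoch (a * q) q n := by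
  rw [add_comm, qPoch_add]
  simp [qPoch]

theorem qPoch_ne_zero {a q : ℂ} (h : ∀ k : ℕ, a * q ^ k ≠ 1) (n : ℕ) : qPoch a q n ≠ 0 :=
  Finset.prod_ne_zero_iff.mpr fun k _ => sub_ne_zero.mpr (h k).symm

theorem mul_pow_ne_one {q a : ℂ} (hq : ‖q‖ < 1) (ha : ‖a‖ < 1) (k : ℕ) : a * q ^ k ≠ 1 := by
  intro h
  have h1 : ‖a‖ * ‖q‖ ^ k = 1 := by rw [← norm_pow, ← norm_mul, h, norm_one]
  have h2 : ‖q‖ ^ k ≤ 1 := pow_le_one₀ (norm_nonneg q) hq.le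
  nlinarith [norm_nonneg a]

theorem tendsto_qPoch (a : ℂ) {q : ℂ} (hq : ‖q‖ < 1) :
    Tendsto (qPoch a q) atTop (𝓝 (qPochInf a q)) :=
  (multipliable_qPochInf a q hq).hasProd.tendsto_prod_nat

theorem qPochInf_ne_zero {a q : ℂ} (hq : ‖q‖ < 1) (h : ∀ k : ℕ, a * q ^ k ≠ 1) :
    qPochInf a q ≠ 0 := by
  have hs : Summable (fun k : ℕ => ‖-(a * q ^ k)‖) := by
    simpa [norm_mul, norm_pow] using
      (summable_geometric_of_lt_one (norm_nonneg q) hq).mul_left ‖a‖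
  have := tprod_one_add_ne_zero_of_summable (f := fun k : ℕ => -(a * q ^ k))
    (fun k => by simpa [← sub_eq_add_neg] using sub_ne_zero.mpr (h k).symm) hs
  simpa [qPochInf, sub_eq_add_neg] using this

theorem qPochInf_eq_mul (a : ℂ) {q : ℂ} (hq : ‖q‖ < 1) (n : ℕ) :
    qPochInf a q = qPoch a q n * qPochInf (a * q ^ n) q := by
  have h1 := ((tendsto_qPoch a hq).comp (tendsto_add_atTop_nat n))
  refine tendsto_nhds_unique h1 (((tendsto_qPoch (a * q ^ n) hq).const_mul _).congr fun k => ?_)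
  rw [Function.comp_apply, add_comm, qPoch_add]

theorem exists_norm_le_of_tendsto {f : ℕ → ℂ} {l : ℂ} (h : Tendsto f atTop (𝓝 l)) :
    ∃ M, 0 ≤ M ∧ ∀ n, ‖f n‖ ≤ M := by
  obtain ⟨M, hM⟩ := (Metric.isBounded_range_of_tendsto f h).exists_norm_le
  exact ⟨M, (norm_nonneg _).trans (hM _ ⟨0, rfl⟩), fun n => hM _ ⟨n, rfl⟩⟩

theorem exists_norm_inv_qPoch_le {a q : ℂ} (hq : ‖q‖ < 1) (h : ∀ k : ℕ, a * q ^ k ≠ 1) :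
    ∃ M, 0 ≤ M ∧ ∀ n, ‖(qPoch a q n)⁻¹‖ ≤ M :=
  exists_norm_le_of_tendsto ((tendsto_qPoch a hq).inv₀ (qPochInf_ne_zero hq h))

/-! ### The `q`-Gauss summation -/

/-- The `n`-th term of the basic hypergeometric series `₂φ₁(A, B; tAB; q, t)`. -/
noncomputable def gaussTerm (A B q t : ℂ) (n : ℕ) : ℂ :=
  qPoch A q n * qPoch B q n * t ^ n / (qPoch q q n * qPoch (t * A * B) q n)

theorem summable_gaussTerm {A B q t : ℂ} (hq : ‖q‖ < 1) (ht : ‖t‖ < 1)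
    (hC : ∀ k : ℕ, t * A * B * q ^ k ≠ 1) : Summable (gaussTerm A B q t) := by
  have hlim : Tendsto (fun n => qPoch A q n * qPoch B q n /
      (qPoch q q n * qPoch (t * A * B) q n)) atTop _ :=
    ((tendsto_qPoch A hq).mul (tendsto_qPoch B hq)).div
      ((tendsto_qPoch q hq).mul (tendsto_qPoch (t * A * B) hq))
      (mul_ne_zero (qPochInf_ne_zero hq (mul_pow_ne_one hq hq)) (qPochInf_ne_zero hq hC))
  obtain ⟨M, -, hM⟩ := exists_norm_le_of_tendsto hlim
  refine Summable.of_norm_bounded ((summable_geometric_of_lt_one (norm_nonneg t) ht).mul_left M)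
    fun n => ?_
  have : gaussTerm A B q t n = qPoch A q n * qPoch B q n /
      (qPoch q q n * qPoch (t * A * B) q n) * t ^ n := by
    rw [gaussTerm]; ring
  rw [this, norm_mul, norm_pow]
  exact mul_le_mul_of_nonneg_right (hM n) (by positivity)

theorem shift_ne_one {C q : ℂ} (hC : ∀ k : ℕ, C * q ^ k ≠ 1) (N k : ℕ) :
    C * q ^ N * q ^ k ≠ 1 := by
  rw [mul_assoc, ← pow_add]; exact hC _

/-- The contiguous relation between `₂φ₁` at `t` and at `tq`; the difference of the two sides
telescopes termwise. -/
theorem tsum_gaussTerm_contiguous {A B q t : ℂ} (hq : ‖q‖ < 1) (ht : ‖t‖ < 1)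
    (hC : ∀ k : ℕ, t * A * B * q ^ k ≠ 1) :
    (1 - t * A * B) * (1 - t) * ∑' n, gaussTerm A B q t n =
      (1 - t * A) * (1 - t * B) * ∑' n, gaussTerm A B q (t * q) n := by
  have hCq : ∀ k : ℕ, t * q * A * B * q ^ k ≠ 1 := fun k => by
    have := shift_ne_one hC 1 k
    rwa [show t * q * A * B = t * A * B * q ^ 1 by ring]
  have htq : ‖t * q‖ < 1 := by
    rw [norm_mul]; exact mul_lt_one_of_nonneg_of_lt_one_left (norm_nonneg t) ht hq.le
  have hs := summable_gaussTerm hq ht hC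
  have hs' := summable_gaussTerm hq htq hCq
  set G : ℕ → ℂ := fun n => -((1 - t * A * B) * gaussTerm A B q t n * (1 - q ^ n)) with hG
  have key : ∀ n, (1 - t * A * B) * (1 - t) * gaussTerm A B q t n -
      (1 - t * A) * (1 - t * B) * gaussTerm A B q (t * q) n = G (n + 1) - G n := by
    intro n
    have e1 : qPoch (t * A * B) q n * (1 - t * A * B * q ^ n) =
        (1 - t * A * B) * qPoch (t * q * A * B) q n := by
      rw [← qPoch_succ, qPoch_succ']
      congr 2; ring
    have n0 : 1 - t * A * B ≠ 0 := sub_ne_zero.mpr (by simpa using (hC 0).symm)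
    have n1 := qPoch_ne_zero hC n
    have n2 : 1 - t * A * B * q ^ n ≠ 0 := sub_ne_zero.mpr (hC n).symm
    have n3 : qPoch q q n ≠ 0 := qPoch_ne_zero (mul_pow_ne_one hq hq) n
    have n4 : 1 - q * q ^ n ≠ 0 := sub_ne_zero.mpr (mul_pow_ne_one hq hq n).symm
    have e2 : qPoch (t * q * A * B) q n =
        qPoch (t * A * B) q n * (1 - t * A * B * q ^ n) / (1 - t * A * B) := by
      rw [e1]; field_simp
    simp only [hG, gaussTerm, qPoch_succ, e2, pow_succ', mul_pow]
    generalize q ^ n = Q at *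
    rw [mul_comm q Q] at n4 ⊢
    field_simp
    ring
  have hsum := (hs.hasSum.mul_left ((1 - t * A * B) * (1 - t))).sub
    (hs'.hasSum.mul_left ((1 - t * A) * (1 - t * B)))
  have hlim : Tendsto G atTop (𝓝 0) := by
    have h1 := tendsto_pow_atTop_nhds_zero_of_norm_lt_one hq
    have h2 := ((hs.tendsto_atTop_zero.const_mul (1 - t * A * B)).mul (h1.const_sub 1)).neg
    simpa [hG] using h2
  have h3 := hsum.tendsto_sum_nat
  simp only [key, Finset.sum_range_sub] at h3
  have h4 := tendsto_nhds_unique h3 (hlim.sub_const (G 0))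
  have h5 : G 0 = 0 := by simp [hG]
  rw [h5, sub_zero] at h4
  exact sub_eq_zero.mp h4

theorem qPoch_mul_tsum_gaussTerm {A B q t : ℂ} (hq : ‖q‖ < 1) (ht : ‖t‖ < 1)
    (hC : ∀ k : ℕ, t * A * B * q ^ k ≠ 1) (N : ℕ) :
    qPoch (t * A * B) q N * qPoch t q N * ∑' n, gaussTerm A B q t n =
      qPoch (t * A) q N * qPoch (t * B) q N * ∑' n, gaussTerm A B q (t * q ^ N) n := by
  induction N with
  | zero => simp [qPoch_zero]
  | succ N ih =>
    have hCN : ∀ k : ℕ, t * q ^ N * A * B * q ^ k ≠ 1 := fun k => by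
      rw [show t * q ^ N * A * B = t * A * B * q ^ N by ring]
      exact shift_ne_one hC N k
    have htN : ‖t * q ^ N‖ < 1 := by
      rw [norm_mul, norm_pow]
      exact mul_lt_one_of_nonneg_of_lt_one_left (norm_nonneg t) ht
        (pow_le_one₀ (norm_nonneg q) hq.le)
    have h := tsum_gaussTerm_contiguous hq htN hCN
    rw [mul_assoc t (q ^ N) q, ← pow_succ] at h
    simp only [qPoch_succ]
    linear_combination (1 - t * A * B * q ^ N) * (1 - t * q ^ N) * ih +
      qPoch (t * A) q N * qPoch (t * B) q N * h

/-- Dominated convergence; the domination is uniform in `N` because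
`(Cq^N; q)_n = (C; q)_{N+n} / (C; q)_N` is bounded away from zero. -/
theorem tendsto_tsum_gaussTerm {A B q t : ℂ} (hq : ‖q‖ < 1) (ht : ‖t‖ < 1)
    (hC : ∀ k : ℕ, t * A * B * q ^ k ≠ 1) :
    Tendsto (fun N => ∑' n, gaussTerm A B q (t * q ^ N) n) atTop (𝓝 1) := by
  have hlim : Tendsto (fun n => qPoch A q n * qPoch B q n / qPoch q q n) atTop _ :=
    ((tendsto_qPoch A hq).mul (tendsto_qPoch B hq)).div (tendsto_qPoch q hq)
      (qPochInf_ne_zero hq (mul_pow_ne_one hq hq))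
  obtain ⟨K₁, h₁, hK₁⟩ := exists_norm_le_of_tendsto hlim
  obtain ⟨K₂, h₂, hK₂⟩ := exists_norm_le_of_tendsto (tendsto_qPoch (t * A * B) hq)
  obtain ⟨K₃, h₃, hK₃⟩ := exists_norm_inv_qPoch_le hq hC
  have bound : ∀ N n, ‖gaussTerm A B q (t * q ^ N) n‖ ≤
      K₁ * K₂ * K₃ * ‖t‖ ^ n * (‖q‖ ^ N) ^ n := by
    intro N n
    have e1 : gaussTerm A B q (t * q ^ N) n = qPoch A q n * qPoch B q n / qPoch q q n *
        qPoch (t * A * B) q N * (qPoch (t * A * B) q (N + n))⁻¹ * t ^ n * (q ^ N) ^ n := by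
      have n1 := qPoch_ne_zero hC N
      have e : t * q ^ N * A * B = t * A * B * q ^ N := by ring
      have n2 := qPoch_ne_zero (shift_ne_one hC N) n
      rw [gaussTerm, qPoch_add, e, mul_pow]
      have n3 : qPoch q q n ≠ 0 := qPoch_ne_zero (mul_pow_ne_one hq hq) n
      field_simp
    rw [e1, norm_mul, norm_mul, norm_mul, norm_mul, norm_pow, norm_pow, norm_pow]
    gcongr
    · exact hK₁ n
    · exact hK₂ N
    · exact hK₃ _
  have h := tendsto_tsum_of_dominated_convergence (𝓕 := atTop)
    (f := fun N n => gaussTerm A B q (t * q ^ N) n) (g := fun n => if n = 0 then (1 : ℂ) else 0)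
    (bound := fun n => K₁ * K₂ * K₃ * ‖t‖ ^ n)
    ((summable_geometric_of_lt_one (norm_nonneg t) ht).mul_left _) ?_ ?_
  · simpa using h
  · intro n
    rcases Nat.eq_zero_or_pos n with rfl | hn
    · simp [gaussTerm, qPoch_zero]
    · rw [if_neg hn.ne']
      refine squeeze_zero_norm (bound · n) ?_
      have h0 : Tendsto (fun N => (‖q‖ ^ N) ^ n) atTop (𝓝 (0 ^ n)) :=
        (tendsto_pow_atTop_nhds_zero_of_lt_one (norm_nonneg q) hq).pow n
      rw [zero_pow hn.ne'] at h0
      simpa using h0.const_mul (K₁ * K₂ * K₃ * ‖t‖ ^ n)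
  · refine Eventually.of_forall fun N n => (bound N n).trans ?_
    refine mul_le_of_le_one_right (by positivity) ?_
    exact pow_le_one₀ (by positivity) (pow_le_one₀ (norm_nonneg q) hq.le)

/-- The `q`-Gauss summation of `₂φ₁(A, B; C; q, C/(AB))`, written with `C = tAB` so that
`A = 0` or `B = 0` need no separate treatment. -/
theorem tsum_gaussTerm {A B q t : ℂ} (hq : ‖q‖ < 1) (ht : ‖t‖ < 1)
    (hC : ∀ k : ℕ, t * A * B * q ^ k ≠ 1) :
    ∑' n, gaussTerm A B q t n =
      qPochInf (t * A) q * qPochInf (t * B) q / (qPochInf (t * A * B) q * qPochInf t q) := by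
  have h1 := ((tendsto_qPoch (t * A * B) hq).mul (tendsto_qPoch t hq)).mul_const
    (∑' n, gaussTerm A B q t n)
  have h2 := ((tendsto_qPoch (t * A) hq).mul (tendsto_qPoch (t * B) hq)).mul
    (tendsto_tsum_gaussTerm hq ht hC)
  have h3 := tendsto_nhds_unique h1 (h2.congr fun N => (qPoch_mul_tsum_gaussTerm hq ht hC N).symm)
  rw [eq_div_iff (mul_ne_zero (qPochInf_ne_zero hq hC)
    (qPochInf_ne_zero hq (mul_pow_ne_one hq ht)))]
  linear_combination h3

/-! ### The Bailey transform -/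

theorem summable_and_tsum_antidiagonal {F : ℕ × ℕ → ℂ} (hF : Summable F) :
    Summable (fun n => ∑ p ∈ antidiagonal n, F p) ∧
      ∑' n, ∑ p ∈ antidiagonal n, F p = ∑' i, ∑' j, F (i, j) := by
  have h := (Finset.HasAntidiagonal.sigmaAntidiagonalEquivProd (A := ℕ)).summable_iff.mpr hF
  have hs : ∀ n, ∑ p ∈ antidiagonal n, F p =
      ∑' p : antidiagonal n, F (p : ℕ × ℕ) := fun n => by
    rw [Finset.tsum_subtype]
  constructor
  · simp only [hs]
    exact h.sigma
  · rw [← hF.tsum_prod, ← (Finset.HasAntidiagonal.sigmaAntidiagonalEquivProd (A := ℕ)).tsum_eq F]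
    simp only [hs]
    exact h.tsum_sigma.symm

/-- Bailey's transform for a bounded sequence `α`, relative to `a` with `aq = cAB`. Interchanging
the two summations leaves an inner sum that the `q`-Gauss formula evaluates. -/
theorem bailey_transform {A B c q : ℂ} {α : ℕ → ℂ} {M : ℝ} (hq : ‖q‖ < 1) (hc : ‖c‖ < 1)
    (hα : ∀ i, ‖α i‖ ≤ M) (hC : ∀ k : ℕ, c * A * B * q ^ k ≠ 1)
    (hA : ∀ k : ℕ, c * A * q ^ k ≠ 1) (hB : ∀ k : ℕ, c * B * q ^ k ≠ 1) :
    Summable (fun n => qPoch A q n * qPoch B q n * c ^ n * ∑ p ∈ antidiagonal n,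
      α p.1 / (qPoch q q p.2 * qPoch (c * A * B) q (p.2 + 2 * p.1))) ∧
    Summable (fun i => qPoch A q i * qPoch B q i * c ^ i * α i /
      (qPoch (c * A) q i * qPoch (c * B) q i)) ∧
    ∑' n, qPoch A q n * qPoch B q n * c ^ n * ∑ p ∈ antidiagonal n,
        α p.1 / (qPoch q q p.2 * qPoch (c * A * B) q (p.2 + 2 * p.1)) =
      qPochInf (c * A) q * qPochInf (c * B) q / (qPochInf (c * A * B) q * qPochInf c q) *
        ∑' i, qPoch A q i * qPoch B q i * c ^ i * α i /
          (qPoch (c * A) q i * qPoch (c * B) q i) := by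
  set F : ℕ × ℕ → ℂ := fun p => qPoch A q (p.1 + p.2) * qPoch B q (p.1 + p.2) * c ^ (p.1 + p.2) *
    (α p.1 / (qPoch q q p.2 * qPoch (c * A * B) q (p.2 + 2 * p.1))) with hFdef
  have hM : 0 ≤ M := (norm_nonneg _).trans (hα 0)
  have hgeo := summable_geometric_of_lt_one (norm_nonneg c) hc
  have hF : Summable F := by
    obtain ⟨K₁, h₁, hK₁⟩ := exists_norm_le_of_tendsto (tendsto_qPoch A hq)
    obtain ⟨K₂, h₂, hK₂⟩ := exists_norm_le_of_tendsto (tendsto_qPoch B hq)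
    obtain ⟨K₃, h₃, hK₃⟩ := exists_norm_inv_qPoch_le hq (mul_pow_ne_one hq hq)
    obtain ⟨K₄, h₄, hK₄⟩ := exists_norm_inv_qPoch_le hq hC
    refine Summable.of_norm_bounded ((hgeo.mul_of_nonneg hgeo (fun n => by positivity)
      (fun n => by positivity)).mul_left (K₁ * K₂ * M * K₃ * K₄)) fun p => ?_
    have e : F p = qPoch A q (p.1 + p.2) * qPoch B q (p.1 + p.2) * α p.1 * (qPoch q q p.2)⁻¹ *
        (qPoch (c * A * B) q (p.2 + 2 * p.1))⁻¹ * (c ^ p.1 * c ^ p.2) := by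
      simp only [hFdef]
      rw [div_eq_mul_inv, mul_inv, pow_add]
      ring
    rw [e]
    simp only [norm_mul, norm_pow]
    gcongr
    · exact hK₁ _
    · exact hK₂ _
    · exact hα _
    · exact hK₃ _
    · exact hK₄ _
  have hanti : ∀ n, qPoch A q n * qPoch B q n * c ^ n * ∑ p ∈ antidiagonal n,
      α p.1 / (qPoch q q p.2 * qPoch (c * A * B) q (p.2 + 2 * p.1)) =
      ∑ p ∈ antidiagonal n, F p := fun n => by
    rw [Finset.mul_sum]
    refine Finset.sum_congr rfl fun p hp => ?_
    rw [← Finset.HasAntidiagonal.mem_antidiagonal.mp hp]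
  have hinner : ∀ i, ∑' j, F (i, j) =
      qPochInf (c * A) q * qPochInf (c * B) q / (qPochInf (c * A * B) q * qPochInf c q) *
        (qPoch A q i * qPoch B q i * c ^ i * α i /
          (qPoch (c * A) q i * qPoch (c * B) q i)) := by
    intro i
    have eC : c * (A * q ^ i) * (B * q ^ i) = c * A * B * q ^ (2 * i) := by ring
    have hC' : ∀ k : ℕ, c * (A * q ^ i) * (B * q ^ i) * q ^ k ≠ 1 := by
      rw [eC]; exact shift_ne_one hC _
    have e : ∀ j, F (i, j) = qPoch A q i * qPoch B q i * c ^ i * α i /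
        qPoch (c * A * B) q (2 * i) * gaussTerm (A * q ^ i) (B * q ^ i) q c j := fun j => by
      simp only [hFdef, gaussTerm, eC]
      rw [add_comm j, qPoch_add, qPoch_add, qPoch_add, pow_add]
      have n1 := qPoch_ne_zero hC (2 * i)
      have n2 := qPoch_ne_zero (shift_ne_one hC (2 * i)) j
      have n3 := qPoch_ne_zero (mul_pow_ne_one hq hq) j
      field_simp
    simp only [e]
    rw [tsum_mul_left, tsum_gaussTerm hq hc hC', eC, ← mul_assoc c A, ← mul_assoc c B,
      qPochInf_eq_mul (c * A) hq i, qPochInf_eq_mul (c * B) hq i,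
      qPochInf_eq_mul (c * A * B) hq (2 * i)]
    have n1 := qPoch_ne_zero hC (2 * i)
    have n2 := qPochInf_ne_zero hq (shift_ne_one hC (2 * i))
    have n3 := qPoch_ne_zero hA i
    have n4 := qPoch_ne_zero hB i
    have n5 := qPochInf_ne_zero hq (mul_pow_ne_one hq hc)
    field_simp
  obtain ⟨hs, hsum⟩ := summable_and_tsum_antidiagonal hF
  have hS : Summable (fun i => qPoch A q i * qPoch B q i * c ^ i * α i /
      (qPoch (c * A) q i * qPoch (c * B) q i)) := by
    have h := hF.prod
    simp only [hinner] at h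
    refine (summable_mul_left_iff ?_).mp h
    exact div_ne_zero (mul_ne_zero (qPochInf_ne_zero hq hA) (qPochInf_ne_zero hq hB))
      (mul_ne_zero (qPochInf_ne_zero hq hC) (qPochInf_ne_zero hq (mul_pow_ne_one hq hc)))
  simp only [hanti]
  refine ⟨hs, hS, ?_⟩
  rw [hsum, ← tsum_mul_left]
  exact tsum_congr hinner

/-! ### A Bailey pair from partial fractions -/

/-- The numerator of the `i`-th coefficient in the partial fraction expansion of
`1 / (zq, xq/z; q)_n` with respect to `z + x/z`. The factor `(1 - q^i) / (q; q)_i` stands for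
`1 / (q; q)_{i-1}` and makes the value at `i = 0` vanish. -/
noncomputable def pairNum (x q : ℂ) (i : ℕ) : ℂ :=
  -((-1) ^ i * q ^ i.choose 2 * ((1 - q ^ i) * qPoch (x * q) q i * (1 - x * q ^ (2 * i)) /
    qPoch q q i))

/-- The sequence `α` of the Bailey pair relative to `x` whose `β` is `1 / (zq, xq/z; q)_n` for
`n ≥ 1` and `0` for `n = 0`. -/
noncomputable def pairAlpha (x z q : ℂ) (i : ℕ) : ℂ :=
  pairNum x q i / ((1 - z * q ^ i) * (1 - x * q ^ i / z))

theorem pairNum_zero (x q : ℂ) : pairNum x q 0 = 0 := by simp [pairNum]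

theorem choose_two_succ (n : ℕ) : (n + 1).choose 2 = n + n.choose 2 := by
  rw [Nat.choose_succ_succ' n 1, Nat.choose_one_right]

/-- Partial sums of the sum of residues, in closed form. The factor `1 - q ^ m` on the
right makes the full sum (`m = 0`) vanish, and `q - q ^ (K + m)` is nonzero once `K + m ≥ 2`. -/
theorem sum_range_pairNum {x q : ℂ} (hq : ‖q‖ < 1) (hx : ∀ k : ℕ, x * q * q ^ k ≠ 1)
    (K m : ℕ) :
    (q - q ^ (K + m)) * ∑ i ∈ Finset.range (K + 1), pairNum x q i * q ^ (K + m - i) /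
      (qPoch q q (K + m - i) * qPoch (x * q) q (K + m + i)) =
    -((-1) ^ K * q ^ (K.choose 2 + K + m) * qPoch (x * q) q (K + 1) * (1 - q ^ K) * (1 - q ^ m) /
      (qPoch q q K * qPoch q q m * qPoch (x * q) q (K + m + K))) := by
  induction K generalizing m with
  | zero => simp [pairNum_zero]
  | succ K ih =>
    have h := ih (m + 1)
    rw [Finset.sum_range_succ, mul_add]
    rw [show K + 1 + m = K + (m + 1) by ring, h, show K + (m + 1) - (K + 1) = m by omega,
      pairNum, choose_two_succ, show K + (m + 1) + (K + 1) = K + (m + 1) + K + 1 by ring]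
    rw [qPoch_succ (x * q) q (K + 1), qPoch_succ (x * q) q (K + (m + 1) + K), qPoch_succ q q K,
      qPoch_succ q q m]
    have n1 := qPoch_ne_zero hx (K + 1)
    have n2 := qPoch_ne_zero hx (K + (m + 1) + K)
    have n3 := qPoch_ne_zero (mul_pow_ne_one hq hq) K
    have n4 := qPoch_ne_zero (mul_pow_ne_one hq hq) m
    have n5 : 1 - q * q ^ K ≠ 0 := sub_ne_zero.mpr (mul_pow_ne_one hq hq K).symm
    have n6 : 1 - q * q ^ m ≠ 0 := sub_ne_zero.mpr (mul_pow_ne_one hq hq m).symm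
    have n7 : 1 - x * q * q ^ (K + (m + 1) + K) ≠ 0 := sub_ne_zero.mpr (hx _).symm
    generalize qPoch (x * q) q (K + 1) = P1 at *
    generalize qPoch (x * q) q (K + (m + 1) + K) = P2 at *
    generalize qPoch q q K = P3 at *
    generalize qPoch q q m = P4 at *
    have e1 : q ^ (K + 1) = q * q ^ K := by ring
    have e2 : q ^ (m + 1) = q * q ^ m := by ring
    have e3 : q ^ (K + (m + 1) + K) = q * q ^ m * (q ^ K) ^ 2 := by ring
    have e4 : q ^ (K + (m + 1)) = q * q ^ m * q ^ K := by ring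
    have e5 : q ^ (K.choose 2 + K + (m + 1)) = q ^ K.choose 2 * q ^ K * (q * q ^ m) := by ring
    have e6 : q ^ (K + K.choose 2 + (K + 1) + m) =
      q ^ K.choose 2 * (q ^ K) ^ 2 * q * q ^ m := by ring
    have e7 : q ^ (K + K.choose 2) = q ^ K.choose 2 * q ^ K := by ring
    have e8 : q ^ (2 * (K + 1)) = q ^ 2 * (q ^ K) ^ 2 := by ring
    rw [e3] at n7
    simp only [e1, e2, e3, e4, e5, e6, e7, e8, pow_succ (-1 : ℂ)]
    generalize q ^ K.choose 2 = X at *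
    generalize q ^ K = Y at *
    generalize q ^ m = Z at *
    generalize (-1 : ℂ) ^ K = S at *
    generalize hD : 1 - x * q * (q * Z * Y ^ 2) = D at n7 ⊢
    generalize 1 - q * Y = E at n5 ⊢
    field_simp
    rw [← hD]
    ring

theorem sum_antidiagonal_pairNum {x q : ℂ} (hq0 : q ≠ 0) (hq : ‖q‖ < 1)
    (hx : ∀ k : ℕ, x * q * q ^ k ≠ 1) (n : ℕ) :
    ∑ p ∈ antidiagonal (n + 1), pairNum x q p.1 * q ^ p.2 /
      (qPoch q q p.2 * qPoch (x * q) q (p.2 + 2 * p.1)) = if n = 0 then 1 else 0 := by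
  split_ifs with hn
  · subst hn
    have n1 : 1 - x * q ≠ 0 := sub_ne_zero.mpr (by simpa using (hx 0).symm)
    have n2 : 1 - x * q * q ≠ 0 := sub_ne_zero.mpr (by simpa using (hx 1).symm)
    have n3 : 1 - q ≠ 0 := sub_ne_zero.mpr (by simpa using (mul_pow_ne_one hq hq 0).symm)
    simp [Finset.Nat.antidiagonal_succ, pairNum, qPoch, Finset.prod_range_succ]
    field_simp
    exact div_self (mul_ne_zero (by convert n1 using 1; ring) (by convert n2 using 1; ring))
  · have h := sum_range_pairNum hq hx (n + 1) 0
    have hne : q - q ^ (n + 1 + 0) ≠ 0 := by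
      have h1 : q ^ (n + 1 + 0) = q * (q * q ^ (n - 1)) := by
        obtain ⟨k, rfl⟩ := Nat.exists_eq_add_one_of_ne_zero hn
        rw [Nat.add_sub_cancel]; ring
      rw [h1, ← mul_one_sub]
      exact mul_ne_zero hq0 (sub_ne_zero.mpr (mul_pow_ne_one hq hq _).symm)
    rw [pow_zero, sub_self, mul_zero, zero_div, neg_zero, mul_eq_zero, or_iff_right hne] at h
    rw [Finset.Nat.sum_antidiagonal_eq_sum_range_succ_mk, ← h]
    refine Finset.sum_congr rfl fun i hi => ?_
    have : i ≤ n + 1 := Nat.lt_succ_iff.mp (Finset.mem_range.mp hi)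
    simp only [add_zero]
    rw [show n + 1 - i + 2 * i = n + 1 + i by omega]

/-- The Bailey pair relation. The sums on the left satisfy the same first-order recurrence in `n`
as the right-hand side, because `(1 - zqⁿ)(1 - xqⁿ/z)` with `n = i + j` equals
`(1 - q^j)(1 - xq^(n+i)) + q^j (1 - zq^i)(1 - xq^i/z)`. -/
theorem sum_antidiagonal_pairAlpha {x z q : ℂ} (hq0 : q ≠ 0) (hq : ‖q‖ < 1) (hz : z ≠ 0)
    (hx : ∀ k : ℕ, x * q * q ^ k ≠ 1) (hzq : ∀ k : ℕ, z * q * q ^ k ≠ 1)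
    (hxz : ∀ k : ℕ, x * q / z * q ^ k ≠ 1) (n : ℕ) :
    ∑ p ∈ antidiagonal n, pairAlpha x z q p.1 /
      (qPoch q q p.2 * qPoch (x * q) q (p.2 + 2 * p.1)) =
    1 / (qPoch (z * q) q n * qPoch (x * q / z) q n) - if n = 0 then 1 else 0 := by
  have fac : ∀ k : ℕ, (1 - z * q ^ (k + 1)) * (1 - x * q ^ (k + 1) / z) ≠ 0 := fun k =>
    mul_ne_zero (sub_ne_zero.mpr fun h => hzq k (by rw [h]; ring))
      (sub_ne_zero.mpr fun h => hxz k (by rw [h]; ring))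
  -- At `i = 0` both sides vanish, even if `z = 1` or `x = z`.
  have hαp : ∀ i, pairAlpha x z q i * ((1 - z * q ^ i) * (1 - x * q ^ i / z)) = pairNum x q i := by
    intro i
    rcases i with _ | k
    · simp [pairAlpha, pairNum_zero]
    · rw [pairAlpha, div_mul_cancel₀ _ (fac k)]
  induction n with
  | zero => simp [pairAlpha, pairNum_zero, qPoch_zero]
  | succ n ih =>
    have hrec : (1 - z * q ^ (n + 1)) * (1 - x * q ^ (n + 1) / z) *
        ∑ p ∈ antidiagonal (n + 1), pairAlpha x z q p.1 /
          (qPoch q q p.2 * qPoch (x * q) q (p.2 + 2 * p.1)) =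
        ∑ p ∈ antidiagonal n, pairAlpha x z q p.1 /
          (qPoch q q p.2 * qPoch (x * q) q (p.2 + 2 * p.1)) +
        ∑ p ∈ antidiagonal (n + 1), pairNum x q p.1 * q ^ p.2 /
          (qPoch q q p.2 * qPoch (x * q) q (p.2 + 2 * p.1)) := by
      rw [Finset.Nat.sum_antidiagonal_succ', Finset.Nat.sum_antidiagonal_succ', mul_add,
        Finset.mul_sum, add_left_comm, ← Finset.sum_add_distrib]
      congr 1
      · rw [← hαp (n + 1)]
        ring
      · refine Finset.sum_congr rfl fun p hp => ?_
        obtain ⟨i, j⟩ := p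
        have hn : i + j = n := Finset.HasAntidiagonal.mem_antidiagonal.mp hp
        subst hn
        simp only
        rw [← hαp i, show j + 1 + 2 * i = j + 2 * i + 1 by ring, qPoch_succ, qPoch_succ]
        have n1 := qPoch_ne_zero hx (j + 2 * i)
        have n2 := qPoch_ne_zero (mul_pow_ne_one hq hq) j
        have n3 : 1 - q * q ^ j ≠ 0 := sub_ne_zero.mpr (mul_pow_ne_one hq hq j).symm
        have n4 : 1 - x * q * q ^ (j + 2 * i) ≠ 0 := sub_ne_zero.mpr (hx _).symm
        have e1 : q ^ (j + 2 * i) = q ^ j * (q ^ i) ^ 2 := by ring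
        have e2 : q ^ (i + j + 1) = q ^ j * q ^ i * q := by ring
        have e3 : q ^ (j + 1) = q ^ j * q := by ring
        rw [e1] at n4
        simp only [e1, e2, e3]
        generalize pairAlpha x z q i = a at *
        generalize qPoch (x * q) q (j + 2 * i) = P at *
        generalize qPoch q q j = Q at *
        generalize q ^ j = J at *
        generalize q ^ i = I at *
        generalize hD : 1 - x * q * (J * I ^ 2) = D at n4 ⊢
        generalize hE : 1 - q * J = E at n3 ⊢
        field_simp
        rw [← hD, ← hE]
        ring
    rw [ih, sum_antidiagonal_pairNum hq0 hq hx, sub_add_cancel] at hrec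
    rw [if_neg n.succ_ne_zero, sub_zero, eq_comm, ← mul_right_inj' (fac n), hrec, qPoch_succ,
      qPoch_succ]
    have n1 := qPoch_ne_zero hzq n
    have n2 := qPoch_ne_zero hxz n
    have n3 : 1 - z * q * q ^ n ≠ 0 := sub_ne_zero.mpr (hzq n).symm
    have n4 : 1 - x * q / z * q ^ n ≠ 0 := sub_ne_zero.mpr (hxz n).symm
    rw [show z * q ^ (n + 1) = z * q * q ^ n by ring,
      show x * q ^ (n + 1) / z = x * q / z * q ^ n by ring]
    generalize 1 - x * q / z * q ^ n = D at n4 ⊢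
    field_simp

/-- Apart from the factor `(-1)^i q^(i choose 2)`, of norm at most one, `α` is convergent. -/
theorem exists_norm_pairAlpha_le {q : ℂ} (x z : ℂ) (hq : ‖q‖ < 1) :
    ∃ M, ∀ i, ‖pairAlpha x z q i‖ ≤ M := by
  have hpow := tendsto_pow_atTop_nhds_zero_of_norm_lt_one hq
  have hpow2 : Tendsto (fun i : ℕ => q ^ (2 * i)) atTop (𝓝 0) :=
    hpow.comp (tendsto_id.const_mul_atTop' (by norm_num))
  have hden : Tendsto (fun i : ℕ => (1 - z * q ^ i) * (1 - x * q ^ i / z)) atTop (𝓝 1) := by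
    simpa using ((hpow.const_mul z).const_sub 1).mul
      (((hpow.const_mul x).div_const z).const_sub 1)
  have hlim := ((((hpow.const_sub 1).mul (tendsto_qPoch (x * q) hq)).mul
    ((hpow2.const_mul x).const_sub 1)).div (tendsto_qPoch q hq)
      (qPochInf_ne_zero hq (mul_pow_ne_one hq hq))).div hden one_ne_zero
  obtain ⟨M, -, hM⟩ := exists_norm_le_of_tendsto hlim
  refine ⟨M, fun i => ?_⟩
  rw [pairAlpha, pairNum, neg_div, norm_neg, mul_div_assoc, norm_mul, norm_mul, norm_pow, norm_neg,
    norm_one, one_pow, one_mul, norm_pow]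
  exact (mul_le_of_le_one_left (norm_nonneg _) (pow_le_one₀ (norm_nonneg q) hq.le)).trans (hM i)

/-! ### The Lambert-type series of the rank generating function -/

theorem choose_two_exponent (n : ℕ) : n * (n + 3) / 2 = n.choose 2 + 2 * n := by
  induction n with
  | zero => rfl
  | succ n ih =>
    have h : (n + 1) * (n + 1 + 3) = n * (n + 3) + 2 * (n + 2) := by ring
    rw [h, Nat.add_mul_div_left _ _ two_pos, ih, choose_two_succ]
    ring

theorem proposition2p2 (d e x z q : ℂ)
    (hq0 : q ≠ 0) (hq1 : ‖q‖ < 1) (hd : d ≠ 0) (he : e ≠ 0) (hz : z ≠ 0)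
    (hconv : ‖x * d * e * q‖ < 1)
    (hzq : ∀ n : ℕ, 1 ≤ n → z * q ^ n ≠ 1)
    (hxz : ∀ n : ℕ, 1 ≤ n → x * q ^ n / z ≠ 1)
    (hx : ∀ n : ℕ, 1 ≤ n → x * q ^ n ≠ 1)
    (hxd : ∀ n : ℕ, 1 ≤ n → -(x * d * q ^ n) ≠ 1)
    (hxe : ∀ n : ℕ, 1 ≤ n → -(x * e * q ^ n) ≠ 1) :
    Summable (fun n : ℕ => rankTerm d e x z q n) ∧
    Summable (fun n : ℕ => lambertTerm d e x z q (n + 1)) ∧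
    ∑' n : ℕ, rankTerm d e x z q n =
      1 - qPochInf (-(x * q * d)) q * qPochInf (-(x * q * e)) q /
            (qPochInf (x * q) q * qPochInf (x * q * d * e) q) *
          ∑' n : ℕ, lambertTerm d e x z q (n + 1) := by
  have eA : x * d * e * q * (-1 / d) = -(x * e * q) := by field_simp
  have eB : x * d * e * q * (-1 / e) = -(x * d * q) := by field_simp
  have eC : x * d * e * q * (-1 / d) * (-1 / e) = x * q := by field_simp
  have hx' : ∀ k : ℕ, x * q * q ^ k ≠ 1 := fun k h => hx (k + 1) k.succ_pos (by rw [← h]; ring)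
  have hzq' : ∀ k : ℕ, z * q * q ^ k ≠ 1 := fun k h => hzq (k + 1) k.succ_pos (by rw [← h]; ring)
  have hxz' : ∀ k : ℕ, x * q / z * q ^ k ≠ 1 := fun k h =>
    hxz (k + 1) k.succ_pos (by rw [← h]; ring)
  have hxd' : ∀ k : ℕ, -(x * d * q) * q ^ k ≠ 1 := fun k h =>
    hxd (k + 1) k.succ_pos (by rw [← h]; ring)
  have hxe' : ∀ k : ℕ, -(x * e * q) * q ^ k ≠ 1 := fun k h =>
    hxe (k + 1) k.succ_pos (by rw [← h]; ring)
  obtain ⟨M, hM⟩ := exists_norm_pairAlpha_le x z hq1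
  obtain ⟨h1, h2, h3⟩ := bailey_transform (A := -1 / d) (B := -1 / e) (c := x * d * e * q) hq1
    hconv hM (by rwa [eC]) (by rwa [eA]) (by rwa [eB])
  simp only [eC] at h1 h3
  simp only [eA, eB, sum_antidiagonal_pairAlpha hq0 hq1 hz hx' hzq' hxz'] at h1 h2 h3
  have hrank : ∀ n, qPoch (-1 / d) q n * qPoch (-1 / e) q n * (x * d * e * q) ^ n *
      (1 / (qPoch (z * q) q n * qPoch (x * q / z) q n) - if n = 0 then 1 else 0) =
      rankTerm d e x z q n - if n = 0 then 1 else 0 := by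
    intro n
    rcases n with _ | n
    · simp [rankTerm, qPoch_zero]
    · simp [rankTerm, div_eq_mul_inv]
  -- The sign of `pairAlpha` is where the minus sign of the statement comes from.
  have hlambert : ∀ n, qPoch (-1 / d) q (n + 1) * qPoch (-1 / e) q (n + 1) *
      (x * d * e * q) ^ (n + 1) * pairAlpha x z q (n + 1) /
        (qPoch (-(x * e * q)) q (n + 1) * qPoch (-(x * d * q)) q (n + 1)) =
      -lambertTerm d e x z q (n + 1) := by
    intro n
    have m1 : 1 - q ^ (n + 1) ≠ 0 := sub_ne_zero.mpr fun h =>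
      mul_pow_ne_one hq1 hq1 n (by rw [h]; ring)
    have m2 : qPoch q q n ≠ 0 := qPoch_ne_zero (mul_pow_ne_one hq1 hq1) n
    have m3 : 1 - z * q ^ (n + 1) ≠ 0 := sub_ne_zero.mpr (hzq _ n.succ_pos).symm
    have m4 : 1 - x * q ^ (n + 1) / z ≠ 0 := sub_ne_zero.mpr (hxz _ n.succ_pos).symm
    have m5 : q ^ (n + 1) ≠ 0 := pow_ne_zero _ hq0
    have m6 : qPoch q q (n + 1) = qPoch q q n * (1 - q ^ (n + 1)) := by
      rw [qPoch_succ, pow_succ' q n]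
    have e1 : 1 / (q ^ (n + 1) * (1 - z * q ^ (n + 1))) + x * z⁻¹ / (1 - x * q ^ (n + 1) / z) =
        (1 - x * q ^ (2 * (n + 1))) /
          (q ^ (n + 1) * ((1 - z * q ^ (n + 1)) * (1 - x * q ^ (n + 1) / z))) := by
      rw [show q ^ (2 * (n + 1)) = (q ^ (n + 1)) ^ 2 by ring]
      rw [div_add_div _ _ (mul_ne_zero m5 m3) m4, mul_assoc]
      congr 1
      · field_simp
        ring
      · ring
    have e2 : (-(d * e * x)) ^ (n + 1) =
        (-1) ^ (n + 1) * (x * d * e * q) ^ (n + 1) / q ^ (n + 1) := by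
      rw [eq_div_iff m5, ← mul_pow, ← mul_pow]; congr 1; ring
    rw [lambertTerm, e1, e2, choose_two_exponent, Nat.add_sub_cancel, pairAlpha, pairNum, m6,
      show q ^ ((n + 1).choose 2 + 2 * (n + 1)) =
        q ^ (n + 1).choose 2 * q ^ (n + 1) * q ^ (n + 1) by ring]
    have m7 := qPoch_ne_zero hxd' (n + 1)
    have m8 := qPoch_ne_zero hxe' (n + 1)
    generalize 1 - x * q ^ (n + 1) / z = D4 at *
    generalize 1 - z * q ^ (n + 1) = D3 at *
    generalize 1 - q ^ (n + 1) = D1 at *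
    generalize 1 - x * q ^ (2 * (n + 1)) = D0 at *
    generalize (x * d * e * q) ^ (n + 1) = t at *
    generalize q ^ (n + 1) = Q at *
    clear e1 e2 m6
    generalize q ^ (n + 1).choose 2 = R at *
    generalize (-1 : ℂ) ^ (n + 1) = u at *
    field_simp
  simp only [hrank] at h1 h3
  have hδ := hasSum_ite_eq (0 : ℕ) (1 : ℂ)
  have hR : Summable (fun n => rankTerm d e x z q n) :=
    (h1.add hδ.summable).congr fun n => by simp
  have hL : Summable (fun n => lambertTerm d e x z q (n + 1)) := by
    have h := (summable_nat_add_iff 1).mpr h2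
    simp only [hlambert] at h
    exact summable_neg_iff.mp h
  refine ⟨hR, hL, ?_⟩
  rw [hR.tsum_sub hδ.summable, hδ.tsum_eq, h2.tsum_eq_zero_add] at h3
  simp only [hlambert] at h3
  rw [tsum_neg, show pairAlpha x z q 0 = 0 by simp [pairAlpha, pairNum_zero], mul_zero, zero_div,
    zero_add] at h3
  rw [show x * q * d * e = x * d * e * q by ring, show x * q * d = x * d * q by ring,
    show x * q * e = x * e * q by ring]
  linear_combination h3
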